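/- Let $R$ be an associative unital ring (not necessarily commutative) and $n\in\mathbb N$. For $a=1,2$ let $\mathbf u^{(a)}_0=1,\mathbf u^{(a)}_1,\dots,\mathbf u^{(a)}_n\in R$ and let $\mathbf L^{\pm(a)}$ be $n\times n$ matrices over $R$ with $\mathbf L^{+(a)}$ upper triangular, $\mathbf L^{-(a)}$ lower triangular, $\mathbf L^{+(a)}_{ii}=\mathbf u^{(a)}_i$ and $\mathbf L^{-(a)}_{ii}=\mathbf u^{(a)}_{i-1}$. Put $\mathbf J=\mathbf L^{-(1)}\mathbf L^{+(2)}$ and $$\mathbf M=\begin{pmatrix}\mathbf 0&\mathbf L^{-(1)}\mathbf L^{-(2)}\\ \mathbf L^{+(1)}\mathbf L^{+(2)}&\mathbf J\end{pmatrix},$$ with rows and columns indexed by $\bar1,\dots,\bar n,1,\dots,n$ (overlined indices belong to the first block). Superscripts denote the selected rows and subscripts the selected columns of a submatrix. For a square matrix $A$ whose submatrix $A^{ij}$ (row $i$ and column $j$ deleted) is invertible, the quasi-determinant is $|A|_{ij}=a_{ij}-\sum_{k\ne j,\,l\ne i}a_{ik}((A^{ij})^{-1})_{kl}a_{lj}$.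 For a matrix $A$ with $m$ rows, the left quasi-Plücker coordinate is $q^{j_1,\dots,j_{m-1}}_{ij}(A)=|A_{i,j_1,\dots,j_{m-1}}|_{si}^{-1}\,|A_{j,j_1,\dots,j_{m-1}}|_{sj}$, computed with any row $s$ for which $|A_{i,j_1,\dots,j_{m-1}}|_{si}$ is defined and invertible; it does not depend on $s$. For a matrix $A$ with $m$ columns, the right one is $r^{i_1,\dots,i_{m-1}}_{ij}(A)=|A^{i,i_1,\dots,i_{m-1}}|_{it}\,|A^{j,i_1,\dots,i_{m-1}}|_{jt}^{-1}$, computed with any column $t$ for which $|A^{j,i_1,\dots,i_{m-1}}|_{jt}$ is defined and invertible; it does not depend on $t$. A coordinate is well defined if such an $s$ (resp. $t$) exists. Write $$q_{k,y}=q^{k+1,\dots,n}_{k\,y}\big(\mathbf M^{k,\dots,n}_{\bar1,\dots,\bar n,1,\dots,n}\big),\qquad r_{y,\bar k}=r^{k+1,\dots,n}_{y\,\bar k}\big(\mathbf M^{\bar1,\dots,\bar n,1,\dots,n}_{k,\dots,n}\big).$$ Assume that $\mathbf u^{(1)}_k\mathbf u^{(2)}_k$ is invertible for $0\le k\le n-1$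 and that $\mathbb H_k:=|\mathbf J^{k,\dots,n}_{k,\dots,n}|_{kk}$ is well defined and invertible for $1\le k\le n$. Then all coordinates $q_{k,y}$ and $r_{y,\bar k}$ are well defined. Define upper triangular matrices $\widetilde{\mathbf L}^{+(a)}$ and lower triangular matrices $\widetilde{\mathbf L}^{-(a)}$ by setting, for $1\le i\le j\le n$, $$\widetilde{\mathbf L}^{+(1)}_{ij}=q_{1,\bar1}q_{2,\bar2}\cdots q_{i-1,\overline{i-1}}\;q_{i,\bar j},\qquad \widetilde{\mathbf L}^{-(1)}_{ji}=q_{1,\bar1}q_{2,\bar2}\cdots q_{j-1,\overline{j-1}}\;q_{j,i},$$ $$\widetilde{\mathbf L}^{+(2)}_{ij}=r_{i,\bar j}\;r_{j-1,\overline{j-1}}\cdots r_{2,\bar2}\,r_{1,\bar1},\qquad \widetilde{\mathbf L}^{-(2)}_{ji}=r_{\bar j,\bar i}\;r_{i-1,\overline{i-1}}\cdots r_{2,\bar2}\,r_{1,\bar1}.$$ (1) These expressions coincide with the following quasi-determinant expressions of the Yang–Baxter map: for $1\le i\le j\le n$, with $\overrightarrow\prod$ and $\overleftarrow\prod$ ordered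 by increasing, resp. decreasing, $k$ from left to right, $$\widetilde{\mathbf L}^{+(1)}_{ij}=\Big(\overrightarrow{\prod_{k=1}^{i-1}}\mathbb H_k^{-1}\mathbf u^{(1)}_k\mathbf u^{(2)}_k\Big)\mathbb H_i^{-1}\,\big|(\mathbf L^{+(1)}\mathbf L^{+(2)})^{i,\dots,n}_{\bar j}\;\;\mathbf J^{i,\dots,n}_{i+1,\dots,n}\big|_{i\bar j},$$ $$\widetilde{\mathbf L}^{-(1)}_{ji}=\Big(\overrightarrow{\prod_{k=1}^{j-1}}\mathbb H_k^{-1}\mathbf u^{(1)}_k\mathbf u^{(2)}_k\Big)\mathbb H_j^{-1}\,\big|\mathbf J^{j,j+1,\dots,n}_{i,j+1,\dots,n}\big|_{ji},$$ $$\widetilde{\mathbf L}^{+(2)}_{ij}=\big|\mathbf J^{i,j+1,\dots,n}_{j,j+1,\dots,n}\big|_{ij}\overleftarrow{\prod_{k=1}^{j-1}}(\mathbf u^{(1)}_k\mathbf u^{(2)}_k)^{-1}\mathbb H_k,$$ $$\widetilde{\mathbf L}^{-(2)}_{ji}=\begin{vmatrix}(\mathbf L^{-(1)}\mathbf L^{-(2)})^{\bar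 j}_{i,\dots,n}\\ \mathbf J^{i+1,\dots,n}_{i,\dots,n}\end{vmatrix}_{\bar j i}\overleftarrow{\prod_{k=1}^{i-1}}(\mathbf u^{(1)}_k\mathbf u^{(2)}_k)^{-1}\mathbb H_k.$$ (2) There are $\widetilde{\mathbf u}^{(a)}_0=1,\widetilde{\mathbf u}^{(a)}_1,\dots,\widetilde{\mathbf u}^{(a)}_n\in R$ with $\widetilde{\mathbf L}^{+(a)}_{ii}=\widetilde{\mathbf u}^{(a)}_i$ and $\widetilde{\mathbf L}^{-(a)}_{ii}=\widetilde{\mathbf u}^{(a)}_{i-1}$ for $1\le i\le n$, $a=1,2$, and the zero-curvature relation holds: $$\mathbf L^{+(1)}\mathbf L^{+(2)}=\widetilde{\mathbf L}^{+(2)}\widetilde{\mathbf L}^{+(1)},\quad \mathbf L^{-(1)}\mathbf L^{+(2)}=\widetilde{\mathbf L}^{+(2)}\widetilde{\mathbf L}^{-(1)},\quad \mathbf L^{-(1)}\mathbf L^{-(2)}=\widetilde{\mathbf L}^{-(2)}\widetilde{\mathbf L}^{-(1)}.$$ -/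

import Mathlib

/-! ### Quasi-determinants over an arbitrary, not necessarily commutative, ring -/

/-- The `(i, j)`-th quasi-determinant of the square matrix `A` is well defined: the matrix `A^{ij}`,
obtained from `A` by deleting row `i` and column `j`, is invertible. -/
def QuasiDetDefined {R : Type*} [Ring R] {m : ℕ} (A : Matrix (Fin (m + 1)) (Fin (m + 1)) R)
    (i j : Fin (m + 1)) : Prop :=
  IsUnit (A.submatrix i.succAbove j.succAbove)

/-- The `(i, j)`-th quasi-determinant `a_ij - ∑ a_ik ((A^{ij})⁻¹)_kl a_lj`, with `k ≠ j`, `l ≠ i`.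
For a `1 × 1` matrix it is the entry. It is meaningful when `QuasiDetDefined A i j`. -/
noncomputable def quasiDet {R : Type*} [Ring R] {m : ℕ}
    (A : Matrix (Fin (m + 1)) (Fin (m + 1)) R) (i j : Fin (m + 1)) : R :=
  A i j - ∑ k, ∑ l, A i (j.succAbove k) *
    Ring.inverse (A.submatrix i.succAbove j.succAbove) k l * A (i.succAbove l) j

/-! ### Quasi-Plücker coordinates -/

/-- The row `s` may be used to compute the left quasi-Plücker coordinates with lower left index `i`
and upper indices `c`: the quasi-determinants at row `s` are well defined and the one to be
inverted is invertible. -/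
def LeftQPAdmissible {R : Type*} [Ring R] {m : ℕ} {κ : Type*} (A : Matrix (Fin (m + 1)) κ R)
    (c : Fin m → κ) (i : κ) (s : Fin (m + 1)) : Prop :=
  QuasiDetDefined (A.submatrix id (Fin.cons i c : Fin (m + 1) → κ)) s 0 ∧
    IsUnit (quasiDet (A.submatrix id (Fin.cons i c : Fin (m + 1) → κ)) s 0)

/-- `|A_{i, c}|_{s i}⁻¹ |A_{j, c}|_{s j}`. -/
noncomputable def leftQPAt {R : Type*} [Ring R] {m : ℕ} {κ : Type*}
    (A : Matrix (Fin (m + 1)) κ R) (c : Fin m → κ) (i j : κ) (s : Fin (m + 1)) : R :=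
  Ring.inverse (quasiDet (A.submatrix id (Fin.cons i c : Fin (m + 1) → κ)) s 0) *
    quasiDet (A.submatrix id (Fin.cons j c : Fin (m + 1) → κ)) s 0

/-- The left quasi-Plücker coordinate `q^c_{ij}(A)` is well defined. -/
def LeftQPDefined {R : Type*} [Ring R] {m : ℕ} {κ : Type*} (A : Matrix (Fin (m + 1)) κ R)
    (c : Fin m → κ) (i : κ) : Prop :=
  ∃ s, LeftQPAdmissible A c i s

open Classical in
/-- The left quasi-Plücker coordinate `q^c_{ij}(A) = |A_{i, c}|_{s i}⁻¹ |A_{j, c}|_{s j}`, for any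
admissible row `s` (see `leftQP_eq` for the independence of `s`). -/
noncomputable def leftQP {R : Type*} [Ring R] {m : ℕ} {κ : Type*}
    (A : Matrix (Fin (m + 1)) κ R) (c : Fin m → κ) (i j : κ) : R :=
  if h : LeftQPDefined A c i then leftQPAt A c i j h.choose else 0

/-- The column `t` may be used to compute the right quasi-Plücker coordinates with lower right
index `j` and upper indices `c`. -/
def RightQPAdmissible {R : Type*} [Ring R] {m : ℕ} {κ : Type*} (A : Matrix κ (Fin (m + 1)) R)
    (c : Fin m → κ) (j : κ) (t : Fin (m + 1)) : Prop :=
  QuasiDetDefined (A.submatrix (Fin.cons j c : Fin (m + 1) → κ) id) 0 t ∧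
    IsUnit (quasiDet (A.submatrix (Fin.cons j c : Fin (m + 1) → κ) id) 0 t)

/-- `|A^{i, c}|_{i t} |A^{j, c}|_{j t}⁻¹`. -/
noncomputable def rightQPAt {R : Type*} [Ring R] {m : ℕ} {κ : Type*}
    (A : Matrix κ (Fin (m + 1)) R) (c : Fin m → κ) (i j : κ) (t : Fin (m + 1)) : R :=
  quasiDet (A.submatrix (Fin.cons i c : Fin (m + 1) → κ) id) 0 t *
    Ring.inverse (quasiDet (A.submatrix (Fin.cons j c : Fin (m + 1) → κ) id) 0 t)

/-- The right quasi-Plücker coordinate `r^c_{ij}(A)` is well defined. -/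
def RightQPDefined {R : Type*} [Ring R] {m : ℕ} {κ : Type*} (A : Matrix κ (Fin (m + 1)) R)
    (c : Fin m → κ) (j : κ) : Prop :=
  ∃ t, RightQPAdmissible A c j t

open Classical in
/-- The right quasi-Plücker coordinate `r^c_{ij}(A) = |A^{i, c}|_{i t} |A^{j, c}|_{j t}⁻¹`, for any
admissible column `t` (see `rightQP_eq` for the independence of `t`). -/
noncomputable def rightQP {R : Type*} [Ring R] {m : ℕ} {κ : Type*}
    (A : Matrix κ (Fin (m + 1)) R) (c : Fin m → κ) (i j : κ) : R :=
  if h : RightQPDefined A c j then rightQPAt A c i j h.choose else 0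

/-! ### Well-definedness of the quasi-Plücker coordinates -/

/-- A quasi-determinant written with matrix-vector products. -/
theorem quasiDet_eq_sub_dotProduct {R : Type*} [Ring R] {m : ℕ}
    (A : Matrix (Fin (m + 1)) (Fin (m + 1)) R) (i j : Fin (m + 1)) :
    quasiDet A i j = A i j - dotProduct (fun k => A i (j.succAbove k))
      (Matrix.mulVec (Ring.inverse (A.submatrix i.succAbove j.succAbove))
        (fun l => A (i.succAbove l) j)) := by
  simp only [quasiDet, dotProduct, Matrix.mulVec, Finset.mul_sum, mul_assoc]

/-- A square linear system `B x = y` split along row `s` and column `0`. -/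
theorem mulVec_eq_iff_split {R : Type*} [Ring R] {m : ℕ}
    (B : Matrix (Fin (m + 1)) (Fin (m + 1)) R) (s : Fin (m + 1)) (x y : Fin (m + 1) → R) :
    Matrix.mulVec B x = y ↔
      (B s 0 * x 0 + dotProduct (fun k => B s (Fin.succAbove 0 k)) (fun k => x k.succ) = y s ∧
        (fun l => B (s.succAbove l) 0 * x 0) +
          Matrix.mulVec (B.submatrix s.succAbove (Fin.succAbove 0)) (fun k => x k.succ) =
            fun l => y (s.succAbove l)) := by
  simp only [funext_iff, Fin.forall_iff_succAbove s, Matrix.mulVec, dotProduct,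
    Fin.sum_univ_succ, Pi.add_apply, Matrix.submatrix_apply, Fin.succAbove_zero]

theorem mulVec_mul_right {R : Type*} [Ring R] {m : ℕ}
    (P : Matrix (Fin m) (Fin m) R) (v : Fin m → R) (a : R) :
    Matrix.mulVec P (fun l => v l * a) = fun l => Matrix.mulVec P v l * a := by
  funext l
  simp only [Matrix.mulVec, dotProduct, Finset.sum_mul, mul_assoc]

theorem dotProduct_mul_right {R : Type*} [Ring R] {m : ℕ}
    (w v : Fin m → R) (a : R) :
    dotProduct w (fun l => v l * a) = dotProduct w v * a := by
  simp only [dotProduct, Finset.sum_mul, mul_assoc]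

/-- The left quasi-Plücker coordinate is the first component of the solution of the linear system
with matrix `A_{i, c}` and right hand side the column `j` of `A`. -/
theorem leftQPAt_eq_of_mulVec {R : Type*} [Ring R] {m : ℕ} {κ : Type*}
    (A : Matrix (Fin (m + 1)) κ R) (c : Fin m → κ) (i j : κ) (s : Fin (m + 1))
    (hs : LeftQPAdmissible A c i s) (x : Fin (m + 1) → R)
    (hx : Matrix.mulVec (A.submatrix id (Fin.cons i c : Fin (m + 1) → κ)) x = fun r => A r j) :
    leftQPAt A c i j s = x 0 := by
  obtain ⟨hP, hd⟩ := hs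
  rw [mulVec_eq_iff_split _ s] at hx
  obtain ⟨h1, h2⟩ := hx
  unfold QuasiDetDefined at hP
  have hsub : (A.submatrix id (Fin.cons j c : Fin (m + 1) → κ)).submatrix s.succAbove
      (Fin.succAbove 0) = (A.submatrix id (Fin.cons i c : Fin (m + 1) → κ)).submatrix s.succAbove
      (Fin.succAbove 0) := by
    ext a b
    simp
  have hrow : (fun k => (A.submatrix id (Fin.cons j c : Fin (m + 1) → κ)) s (Fin.succAbove 0 k)) =
      fun k => (A.submatrix id (Fin.cons i c : Fin (m + 1) → κ)) s (Fin.succAbove 0 k) := by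
    funext k
    simp
  have key : quasiDet (A.submatrix id (Fin.cons j c : Fin (m + 1) → κ)) s 0 =
      quasiDet (A.submatrix id (Fin.cons i c : Fin (m + 1) → κ)) s 0 * x 0 := by
    rw [quasiDet_eq_sub_dotProduct, quasiDet_eq_sub_dotProduct, hsub, hrow]
    have hc : (fun l => (A.submatrix id (Fin.cons j c : Fin (m + 1) → κ)) (s.succAbove l) 0) =
        fun l => A (s.succAbove l) j := by
      funext l
      simp
    have h0 : (A.submatrix id (Fin.cons j c : Fin (m + 1) → κ)) s 0 = A s j := by simp
    rw [hc, h0, ← h2, ← h1, Matrix.mulVec_add, Matrix.mulVec_mulVec, Ring.inverse_mul_cancel _ hP,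
      Matrix.one_mulVec, mulVec_mul_right, dotProduct_add, dotProduct_mul_right, sub_mul]
    abel
  rw [leftQPAt, key, ← mul_assoc, Ring.inverse_mul_cancel _ hd, one_mul]

theorem exists_mulVec_eq {R : Type*} [Ring R] {m : ℕ} {κ : Type*}
    (A : Matrix (Fin (m + 1)) κ R) (c : Fin m → κ) (i j : κ) (s : Fin (m + 1))
    (hs : LeftQPAdmissible A c i s) :
    ∃ x : Fin (m + 1) → R,
      Matrix.mulVec (A.submatrix id (Fin.cons i c : Fin (m + 1) → κ)) x = fun r => A r j := by
  obtain ⟨hP, hd⟩ := hs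
  unfold QuasiDetDefined at hP
  set B := A.submatrix id (Fin.cons i c : Fin (m + 1) → κ) with hB
  set P := B.submatrix s.succAbove (Fin.succAbove 0) with hPd
  set w : Fin m → R := fun k => B s (Fin.succAbove 0 k) with hw
  set b : Fin m → R := fun l => B (s.succAbove l) 0 with hb
  set y : Fin m → R := fun l => A (s.succAbove l) j with hy
  have hq : quasiDet B s 0 = B s 0 - dotProduct w (Matrix.mulVec (Ring.inverse P) b) :=
    quasiDet_eq_sub_dotProduct B s 0
  set x0 : R := Ring.inverse (quasiDet B s 0) *
    (A s j - dotProduct w (Matrix.mulVec (Ring.inverse P) y)) with hx0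
  have hdx : quasiDet B s 0 * x0 =
      A s j - dotProduct w (Matrix.mulVec (Ring.inverse P) y) := by
    rw [hx0, ← mul_assoc, Ring.mul_inverse_cancel _ hd, one_mul]
  refine ⟨Fin.cons x0 (Matrix.mulVec (Ring.inverse P) (y - fun l => b l * x0)), ?_⟩
  rw [mulVec_eq_iff_split _ s]
  simp only [Fin.cons_zero, Fin.cons_succ]
  refine ⟨?_, ?_⟩
  · rw [Matrix.mulVec_sub, dotProduct_sub, mulVec_mul_right, dotProduct_mul_right]
    rw [hq, sub_mul] at hdx
    have := congrArg (· + dotProduct w (Matrix.mulVec (Ring.inverse P) y)) hdx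
    simp only [sub_add_cancel] at this
    rw [← this]
    abel
  · change (fun l => b l * x0) + Matrix.mulVec P _ = y
    rw [Matrix.mulVec_mulVec, Ring.mul_inverse_cancel _ hP, Matrix.one_mulVec]
    abel

/-- The left quasi-Plücker coordinate does not depend on the admissible row. -/
theorem leftQP_eq {R : Type*} [Ring R] {m : ℕ} {κ : Type*}
    (A : Matrix (Fin (m + 1)) κ R) (c : Fin m → κ) (i j : κ) (s : Fin (m + 1))
    (hs : LeftQPAdmissible A c i s) : leftQP A c i j = leftQPAt A c i j s := by
  have h : LeftQPDefined A c i := ⟨s, hs⟩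
  obtain ⟨x, hx⟩ := exists_mulVec_eq A c i j s hs
  rw [leftQP, dif_pos h, leftQPAt_eq_of_mulVec A c i j s hs x hx,
    leftQPAt_eq_of_mulVec A c i j _ h.choose_spec x hx]

/-- A square linear system `x B = y` split along row `0` and column `t`. -/
theorem vecMul_eq_iff_split {R : Type*} [Ring R] {m : ℕ}
    (B : Matrix (Fin (m + 1)) (Fin (m + 1)) R) (t : Fin (m + 1)) (x y : Fin (m + 1) → R) :
    Matrix.vecMul x B = y ↔
      (x 0 * B 0 t + dotProduct (fun k => x k.succ) (fun k => B (Fin.succAbove 0 k) t) = y t ∧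
        (fun l => x 0 * B 0 (t.succAbove l)) +
          Matrix.vecMul (fun k => x k.succ) (B.submatrix (Fin.succAbove 0) t.succAbove) =
            fun l => y (t.succAbove l)) := by
  simp only [funext_iff, Fin.forall_iff_succAbove t, Matrix.vecMul, dotProduct,
    Fin.sum_univ_succ, Pi.add_apply, Matrix.submatrix_apply, Fin.succAbove_zero]

/-- A quasi-determinant written with vector-matrix products. -/
theorem quasiDet_eq_sub_dotProduct' {R : Type*} [Ring R] {m : ℕ}
    (A : Matrix (Fin (m + 1)) (Fin (m + 1)) R) (i j : Fin (m + 1)) :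
    quasiDet A i j = A i j - dotProduct (Matrix.vecMul (fun k => A i (j.succAbove k))
      (Ring.inverse (A.submatrix i.succAbove j.succAbove))) (fun l => A (i.succAbove l) j) := by
  rw [quasiDet_eq_sub_dotProduct, Matrix.dotProduct_mulVec]

theorem vecMul_mul_left {R : Type*} [Ring R] {m : ℕ}
    (P : Matrix (Fin m) (Fin m) R) (v : Fin m → R) (a : R) :
    Matrix.vecMul (fun l => a * v l) P = fun l => a * Matrix.vecMul v P l := by
  funext l
  simp only [Matrix.vecMul, dotProduct, Finset.mul_sum, mul_assoc]

theorem dotProduct_mul_left {R : Type*} [Ring R] {m : ℕ}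
    (w v : Fin m → R) (a : R) :
    dotProduct (fun l => a * w l) v = a * dotProduct w v := by
  simp only [dotProduct, Finset.mul_sum, mul_assoc]

/-- The right quasi-Plücker coordinate is the first component of the solution of the linear system
`x A^{j, c} = ` (row `i` of `A`). -/
theorem rightQPAt_eq_of_vecMul {R : Type*} [Ring R] {m : ℕ} {κ : Type*}
    (A : Matrix κ (Fin (m + 1)) R) (c : Fin m → κ) (i j : κ) (t : Fin (m + 1))
    (ht : RightQPAdmissible A c j t) (x : Fin (m + 1) → R)
    (hx : Matrix.vecMul x (A.submatrix (Fin.cons j c : Fin (m + 1) → κ) id) = fun r => A i r) :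
    rightQPAt A c i j t = x 0 := by
  obtain ⟨hP, hd⟩ := ht
  rw [vecMul_eq_iff_split _ t] at hx
  obtain ⟨h1, h2⟩ := hx
  unfold QuasiDetDefined at hP
  have hsub : (A.submatrix (Fin.cons i c : Fin (m + 1) → κ) id).submatrix (Fin.succAbove 0)
      t.succAbove = (A.submatrix (Fin.cons j c : Fin (m + 1) → κ) id).submatrix (Fin.succAbove 0)
      t.succAbove := by
    ext a b
    simp
  have hcol : (fun k => (A.submatrix (Fin.cons i c : Fin (m + 1) → κ) id) (Fin.succAbove 0 k) t) =
      fun k => (A.submatrix (Fin.cons j c : Fin (m + 1) → κ) id) (Fin.succAbove 0 k) t := by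
    funext k
    simp
  have key : quasiDet (A.submatrix (Fin.cons i c : Fin (m + 1) → κ) id) 0 t =
      x 0 * quasiDet (A.submatrix (Fin.cons j c : Fin (m + 1) → κ) id) 0 t := by
    rw [quasiDet_eq_sub_dotProduct', quasiDet_eq_sub_dotProduct', hsub, hcol]
    have hc : (fun l => (A.submatrix (Fin.cons i c : Fin (m + 1) → κ) id) 0 (t.succAbove l)) =
        fun l => A i (t.succAbove l) := by
      funext l
      simp
    have h0 : (A.submatrix (Fin.cons i c : Fin (m + 1) → κ) id) 0 t = A i t := by simp
    rw [hc, h0, ← h2, ← h1, Matrix.add_vecMul, Matrix.vecMul_vecMul, Ring.mul_inverse_cancel _ hP,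
      Matrix.vecMul_one, vecMul_mul_left, add_dotProduct, dotProduct_mul_left, mul_sub]
    abel
  rw [rightQPAt, key, mul_assoc, Ring.mul_inverse_cancel _ hd, mul_one]

theorem exists_vecMul_eq {R : Type*} [Ring R] {m : ℕ} {κ : Type*}
    (A : Matrix κ (Fin (m + 1)) R) (c : Fin m → κ) (i j : κ) (t : Fin (m + 1))
    (ht : RightQPAdmissible A c j t) :
    ∃ x : Fin (m + 1) → R,
      Matrix.vecMul x (A.submatrix (Fin.cons j c : Fin (m + 1) → κ) id) = fun r => A i r := by
  obtain ⟨hP, hd⟩ := ht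
  unfold QuasiDetDefined at hP
  set B := A.submatrix (Fin.cons j c : Fin (m + 1) → κ) id with hB
  set P := B.submatrix (Fin.succAbove 0) t.succAbove with hPd
  set w : Fin m → R := fun k => B (Fin.succAbove 0 k) t with hw
  set b : Fin m → R := fun l => B 0 (t.succAbove l) with hb
  set y : Fin m → R := fun l => A i (t.succAbove l) with hy
  have hq : quasiDet B 0 t = B 0 t - dotProduct (Matrix.vecMul b (Ring.inverse P)) w :=
    quasiDet_eq_sub_dotProduct' B 0 t
  set x0 : R := (A i t - dotProduct (Matrix.vecMul y (Ring.inverse P)) w) *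
    Ring.inverse (quasiDet B 0 t) with hx0
  have hdx : x0 * quasiDet B 0 t =
      A i t - dotProduct (Matrix.vecMul y (Ring.inverse P)) w := by
    rw [hx0, mul_assoc, Ring.inverse_mul_cancel _ hd, mul_one]
  refine ⟨Fin.cons x0 (Matrix.vecMul (y - fun l => x0 * b l) (Ring.inverse P)), ?_⟩
  rw [vecMul_eq_iff_split _ t]
  simp only [Fin.cons_zero, Fin.cons_succ]
  refine ⟨?_, ?_⟩
  · rw [Matrix.sub_vecMul, sub_dotProduct, vecMul_mul_left, dotProduct_mul_left]
    rw [hq, mul_sub] at hdx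
    have := congrArg (· + dotProduct (Matrix.vecMul y (Ring.inverse P)) w) hdx
    simp only [sub_add_cancel] at this
    rw [← this]
    abel
  · change (fun l => x0 * b l) + Matrix.vecMul _ P = y
    rw [Matrix.vecMul_vecMul, Ring.inverse_mul_cancel _ hP, Matrix.vecMul_one]
    abel

/-- The right quasi-Plücker coordinate does not depend on the admissible column. -/
theorem rightQP_eq {R : Type*} [Ring R] {m : ℕ} {κ : Type*}
    (A : Matrix κ (Fin (m + 1)) R) (c : Fin m → κ) (i j : κ) (t : Fin (m + 1))
    (ht : RightQPAdmissible A c j t) : rightQP A c i j = rightQPAt A c i j t := by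
  have h : RightQPDefined A c j := ⟨t, ht⟩
  obtain ⟨x, hx⟩ := exists_vecMul_eq A c i j t ht
  rw [rightQP, dif_pos h, rightQPAt_eq_of_vecMul A c i j t ht x hx,
    rightQPAt_eq_of_vecMul A c i j _ h.choose_spec x hx]

/-! ### The zero-curvature relation -/

/-- The matrices `L⁺`, `L⁻` are upper, resp. lower triangular with diagonals
`L⁺_ii = u_i`, `L⁻_ii = u_{i-1}` for `1 ≤ i ≤ n`, where `u_0 = 1`. -/
structure IsLPair {R : Type*} [Ring R] {n : ℕ} (Lp Lm : Matrix (Fin n) (Fin n) R)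
    (u : Fin (n + 1) → R) : Prop where
  upper : ∀ i j, j < i → Lp i j = 0
  lower : ∀ i j, i < j → Lm i j = 0
  diag_upper : ∀ i, Lp i i = u i.succ
  diag_lower : ∀ i, Lm i i = u i.castSucc
  u_zero : u 0 = 1

/-- The zero-curvature relation; `Lp1` is `L^{+(1)}`, `Tp1` is `L̃^{+(1)}`, and so on. -/
def ZeroCurvature {R : Type*} [Ring R] {n : ℕ}
    (Lp1 Lm1 Lp2 Lm2 Tp1 Tm1 Tp2 Tm2 : Matrix (Fin n) (Fin n) R) : Prop :=
  Lp1 * Lp2 = Tp2 * Tp1 ∧ Lm1 * Lp2 = Tp2 * Tm1 ∧ Lm1 * Lm2 = Tm2 * Tm1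

/-! ### Indices and ordered products

Indices in `Fin n` stand for `1, …, n`. -/

/-- The list of indices `k+1, k+2, …, n`. -/
def tailIdx {n : ℕ} (k : Fin n) : Fin (n - (k.val + 1)) → Fin n :=
  fun l => ⟨k.val + 1 + l.val, by have := l.isLt; omega⟩

/-- The list of indices `i, k+1, k+2, …, n`. -/
def consTail {n : ℕ} (i k : Fin n) : Fin (n - (k.val + 1) + 1) → Fin n :=
  Fin.cons i (tailIdx k)

/-- The product `f_1 f_2 ⋯ f_{i-1}`, in this order. -/
def ascProd {R : Type*} [Ring R] {n : ℕ} (f : Fin n → R) (i : Fin n) : R :=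
  (List.ofFn fun k : Fin i.val => f (k.castLE i.isLt.le)).prod

/-- The product `f_{i-1} ⋯ f_2 f_1`, in this order. -/
def descProd {R : Type*} [Ring R] {n : ℕ} (f : Fin n → R) (i : Fin n) : R :=
  (List.ofFn fun k : Fin i.val => f (k.castLE i.isLt.le)).reverse.prod

/-! ### The map in terms of quasi-determinants -/

/-- `|J^{i, k+1, …, n}_{j, k+1, …, n}|_{ij}`. -/
noncomputable def minorQD {R : Type*} [Ring R] {n : ℕ} (J : Matrix (Fin n) (Fin n) R)
    (k i j : Fin n) : R :=
  quasiDet (J.submatrix (consTail i k) (consTail j k)) 0 0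

/-- The quasi-determinant, at the upper left entry, of the matrix whose first column is column `j`
of `X` and whose other columns are the columns `i+1, …, n` of `J`, all restricted to the rows
`i, i+1, …, n`. -/
noncomputable def colQD {R : Type*} [Ring R] {n : ℕ} (X J : Matrix (Fin n) (Fin n) R)
    (i j : Fin n) : R :=
  quasiDet (Matrix.of fun a =>
    (Fin.cons (X (consTail i i a) j) (fun l => J (consTail i i a) (tailIdx i l)) :
      Fin (n - (i.val + 1) + 1) → R)) 0 0

/-- The quasi-determinant, at the upper left entry, of the matrix whose first row is row `j`
of `X` and whose other rows are the rows `i+1, …, n` of `J`, all restricted to the columns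
`i, i+1, …, n`. -/
noncomputable def rowQD {R : Type*} [Ring R] {n : ℕ} (X J : Matrix (Fin n) (Fin n) R)
    (j i : Fin n) : R :=
  quasiDet (Matrix.of
    (Fin.cons (fun b => X j (consTail i i b)) (fun l b => J (tailIdx i l) (consTail i i b)) :
      Fin (n - (i.val + 1) + 1) → Fin (n - (i.val + 1) + 1) → R)) 0 0

/-- The factor `|J^{k, …, n}_{k, …, n}|_{kk}⁻¹ u_k^{(1)} u_k^{(2)}`. -/
noncomputable def qdFactorAsc {R : Type*} [Ring R] {n : ℕ} (J : Matrix (Fin n) (Fin n) R)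
    (u1 u2 : Fin (n + 1) → R) (k : Fin n) : R :=
  Ring.inverse (minorQD J k k k) * (u1 k.succ * u2 k.succ)

/-- The factor `(u_k^{(1)} u_k^{(2)})⁻¹ |J^{k, …, n}_{k, …, n}|_{kk}`. -/
noncomputable def qdFactorDesc {R : Type*} [Ring R] {n : ℕ} (J : Matrix (Fin n) (Fin n) R)
    (u1 u2 : Fin (n + 1) → R) (k : Fin n) : R :=
  Ring.inverse (u1 k.succ * u2 k.succ) * minorQD J k k k

/-- `L̃^{+(1)}` in terms of quasi-determinants. -/
noncomputable def qdPlus1 {R : Type*} [Ring R] {n : ℕ} (Lp1 Lm1 Lp2 : Matrix (Fin n) (Fin n) R)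
    (u1 u2 : Fin (n + 1) → R) : Matrix (Fin n) (Fin n) R :=
  Matrix.of fun i j => if i ≤ j then
    ascProd (qdFactorAsc (Lm1 * Lp2) u1 u2) i * Ring.inverse (minorQD (Lm1 * Lp2) i i i) *
      colQD (Lp1 * Lp2) (Lm1 * Lp2) i j
  else 0

/-- `L̃^{-(1)}` in terms of quasi-determinants. -/
noncomputable def qdMinus1 {R : Type*} [Ring R] {n : ℕ} (Lm1 Lp2 : Matrix (Fin n) (Fin n) R)
    (u1 u2 : Fin (n + 1) → R) : Matrix (Fin n) (Fin n) R :=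
  Matrix.of fun j i => if i ≤ j then
    ascProd (qdFactorAsc (Lm1 * Lp2) u1 u2) j * Ring.inverse (minorQD (Lm1 * Lp2) j j j) *
      minorQD (Lm1 * Lp2) j j i
  else 0

/-- `L̃^{+(2)}` in terms of quasi-determinants. -/
noncomputable def qdPlus2 {R : Type*} [Ring R] {n : ℕ} (Lm1 Lp2 : Matrix (Fin n) (Fin n) R)
    (u1 u2 : Fin (n + 1) → R) : Matrix (Fin n) (Fin n) R :=
  Matrix.of fun i j => if i ≤ j then
    minorQD (Lm1 * Lp2) j i j * descProd (qdFactorDesc (Lm1 * Lp2) u1 u2) j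
  else 0

/-- `L̃^{-(2)}` in terms of quasi-determinants. -/
noncomputable def qdMinus2 {R : Type*} [Ring R] {n : ℕ} (Lm1 Lp2 Lm2 : Matrix (Fin n) (Fin n) R)
    (u1 u2 : Fin (n + 1) → R) : Matrix (Fin n) (Fin n) R :=
  Matrix.of fun j i => if i ≤ j then
    rowQD (Lm1 * Lm2) (Lm1 * Lp2) j i * descProd (qdFactorDesc (Lm1 * Lp2) u1 u2) i
  else 0

/-! ### The map in terms of quasi-Plücker coordinates of one block matrix -/

/-- The block matrix `M`. Overlined row and column indices are `Sum.inl`, the others `Sum.inr`. -/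
def blockM {R : Type*} [Ring R] {n : ℕ} (Lp1 Lm1 Lp2 Lm2 : Matrix (Fin n) (Fin n) R) :
    Matrix (Fin n ⊕ Fin n) (Fin n ⊕ Fin n) R :=
  Matrix.fromBlocks 0 (Lm1 * Lm2) (Lp1 * Lp2) (Lm1 * Lp2)

/-- The submatrix of `M` formed by the rows `k, k+1, …, n` (not overlined) and all columns. -/
def lowerRows {R : Type*} [Ring R] {n : ℕ} (M : Matrix (Fin n ⊕ Fin n) (Fin n ⊕ Fin n) R)
    (k : Fin n) : Matrix (Fin (n - (k.val + 1) + 1)) (Fin n ⊕ Fin n) R :=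
  M.submatrix (fun a => Sum.inr (consTail k k a)) id

/-- The submatrix of `M` formed by all rows and the columns `k, k+1, …, n` (not overlined). -/
def rightCols {R : Type*} [Ring R] {n : ℕ} (M : Matrix (Fin n ⊕ Fin n) (Fin n ⊕ Fin n) R)
    (k : Fin n) : Matrix (Fin n ⊕ Fin n) (Fin (n - (k.val + 1) + 1)) R :=
  M.submatrix id (fun b => Sum.inr (consTail k k b))

/-- `q^{k+1, …, n}_{k, y}` of the rows `k, …, n` of `M`. -/
noncomputable def leftCoord {R : Type*} [Ring R] {n : ℕ}
    (M : Matrix (Fin n ⊕ Fin n) (Fin n ⊕ Fin n) R) (k : Fin n) (y : Fin n ⊕ Fin n) : R :=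
  leftQP (lowerRows M k) (fun l => Sum.inr (tailIdx k l)) (Sum.inr k) y

/-- `r^{k+1, …, n}_{y, k̄}` of the columns `k, …, n` of `M`. -/
noncomputable def rightCoord {R : Type*} [Ring R] {n : ℕ}
    (M : Matrix (Fin n ⊕ Fin n) (Fin n ⊕ Fin n) R) (k : Fin n) (y : Fin n ⊕ Fin n) : R :=
  rightQP (rightCols M k) (fun l => Sum.inr (tailIdx k l)) y (Sum.inl k)

/-- `L̃^{+(1)}` in terms of quasi-Plücker coordinates. -/
noncomputable def qpPlus1 {R : Type*} [Ring R] {n : ℕ}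
    (M : Matrix (Fin n ⊕ Fin n) (Fin n ⊕ Fin n) R) : Matrix (Fin n) (Fin n) R :=
  Matrix.of fun i j => if i ≤ j then
    ascProd (fun k => leftCoord M k (Sum.inl k)) i * leftCoord M i (Sum.inl j)
  else 0

/-- `L̃^{-(1)}` in terms of quasi-Plücker coordinates. -/
noncomputable def qpMinus1 {R : Type*} [Ring R] {n : ℕ}
    (M : Matrix (Fin n ⊕ Fin n) (Fin n ⊕ Fin n) R) : Matrix (Fin n) (Fin n) R :=
  Matrix.of fun j i => if i ≤ j then
    ascProd (fun k => leftCoord M k (Sum.inl k)) j * leftCoord M j (Sum.inr i)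
  else 0

/-- `L̃^{+(2)}` in terms of quasi-Plücker coordinates. -/
noncomputable def qpPlus2 {R : Type*} [Ring R] {n : ℕ}
    (M : Matrix (Fin n ⊕ Fin n) (Fin n ⊕ Fin n) R) : Matrix (Fin n) (Fin n) R :=
  Matrix.of fun i j => if i ≤ j then
    rightCoord M j (Sum.inr i) * descProd (fun k => rightCoord M k (Sum.inr k)) j
  else 0

/-- `L̃^{-(2)}` in terms of quasi-Plücker coordinates. -/
noncomputable def qpMinus2 {R : Type*} [Ring R] {n : ℕ}
    (M : Matrix (Fin n ⊕ Fin n) (Fin n ⊕ Fin n) R) : Matrix (Fin n) (Fin n) R :=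
  Matrix.of fun j i => if i ≤ j then
    rightCoord M i (Sum.inl j) * descProd (fun k => rightCoord M k (Sum.inr k)) i
  else 0

/-! Everything comes from one factorization of `J = Lm1 * Lp2`. A quasi-determinant whose deleted
block is the trailing block `J^{k+1,…,n}_{k+1,…,n}` is linear in the row and in the column that
border the block. Hence there are an upper unitriangular `V = upperElim J` and a lower unitriangular
`W = lowerElim J` such that the entries of `V * X` are the `colQD X J k j` (`upperElim_mul`) and
those of `Y * W` are the `rowQD Y J j k` (`mul_lowerElim`). A repeated row or column makes such a
quasi-determinant vanish, so `V * J` is lower and `J * W` upper triangular, and `V * J * W = D` is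
the diagonal matrix of the `H_k` (`upperElim_mul_mul_lowerElim`).

Let `P` and `P'` be the diagonal matrices of the ordered products; they telescope to `P' * P = 1`.
The quasi-determinant formulas become `P D⁻¹ V (Lp1 Lp2)`, `P D⁻¹ V J`, `J W P'`, `(Lm1 Lm2) W P'`,
and the zero-curvature relation reduces to `J W D⁻¹ V = 1` and `W D⁻¹ V J = 1`. Both follow from the
factorization because `V` and `W` are invertible.

The quasi-Plücker coordinates, evaluated at row or column `0`, are quotients of the same
quasi-determinants. The left ones have denominator `H_k`; the right ones have denominator
`u_{k-1}^{(1)} u_{k-1}^{(2)}`, by triangularity of `Lm1 * Lm2`. Regrouping the products then gives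
the quasi-determinant formulas. -/

/-! ### Triangular matrices over a noncommutative ring -/

section Triangular

variable {R : Type*} [Ring R] {n : ℕ}

/-- Every nonzero entry of `N` raises the weight `f` by at least one, so a nonzero entry of `N ^ p`
raises it by at least `p`. A general weight covers the upper and the lower triangular case at once.
-/
theorem isNilpotent_of_strictlyTriangular (f : Fin n → ℕ) (N : Matrix (Fin n) (Fin n) R)
    (hN : ∀ i j, f j ≤ f i → N i j = 0) : IsNilpotent N := by
  have key : ∀ (p : ℕ) (i j), f j < f i + p → (N ^ p) i j = 0 := by
    intro p
    induction p with
    | zero =>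
      intro i j h
      rw [pow_zero, Matrix.one_apply_ne]
      rintro rfl
      omega
    | succ p ih =>
      intro i j h
      rw [pow_succ, Matrix.mul_apply]
      refine Finset.sum_eq_zero fun l _ => ?_
      by_cases hl : f l < f i + p
      · rw [ih i l hl, zero_mul]
      · rw [hN l j (by omega), mul_zero]
  -- A crude exponent, chosen only to exceed every weight.
  refine ⟨(∑ j, f j) + 1, ?_⟩
  ext i j
  refine key _ i j ?_
  have := Finset.single_le_sum (f := f) (fun _ _ => Nat.zero_le _) (Finset.mem_univ j)
  omega

theorem isUnit_of_unitriangular (f : Fin n → ℕ) (V : Matrix (Fin n) (Fin n) R)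
    (hV : ∀ i j, f j ≤ f i → V i j = (1 : Matrix (Fin n) (Fin n) R) i j) : IsUnit V := by
  have h : IsNilpotent (1 - V) :=
    isNilpotent_of_strictlyTriangular f _ fun i j hij => by
      rw [Matrix.sub_apply, hV i j hij, sub_self]
  simpa using h.isUnit_one_sub

/-- Over a general `R` a one-sided inverse of a square matrix need not be two-sided. Swapping the
factors is allowed once one of them is known to be a unit, which unitriangularity provides. -/
theorem mul_comm_eq_one_of_isUnit_left {S : Type*} [Monoid S] {a b : S} (ha : IsUnit a)
    (h : a * b = 1) : b * a = 1 :=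
  ha.mul_left_cancel (by rw [← mul_assoc, h, one_mul, mul_one])

theorem mul_comm_eq_one_of_isUnit_right {S : Type*} [Monoid S] {a b : S} (hb : IsUnit b)
    (h : a * b = 1) : b * a = 1 :=
  hb.mul_right_cancel (by rw [mul_assoc, h, one_mul, mul_one])

theorem mul_apply_of_upper {A B : Matrix (Fin n) (Fin n) R} (hA : ∀ i j, j < i → A i j = 0)
    (hB : ∀ i j, j < i → B i j = 0) {i j : Fin n} (hij : j ≤ i) :
    (A * B) i j = if i = j then A i i * B i i else 0 := by
  have h : ∀ l, l ≠ i → A i l * B l j = 0 := fun l hl => by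
    rcases lt_or_gt_of_ne hl with h | h
    · rw [hA i l h, zero_mul]
    · rw [hB l j (hij.trans_lt h), mul_zero]
  rw [Matrix.mul_apply, Finset.sum_eq_single i (fun l _ hl => h l hl) (by simp)]
  split_ifs with e
  · rw [e]
  · rw [hB i j (lt_of_le_of_ne hij (Ne.symm e)), mul_zero]

theorem mul_apply_of_lower {A B : Matrix (Fin n) (Fin n) R} (hA : ∀ i j, i < j → A i j = 0)
    (hB : ∀ i j, i < j → B i j = 0) {i j : Fin n} (hij : i ≤ j) :
    (A * B) i j = if i = j then A i i * B i i else 0 := by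
  have h : ∀ l, l ≠ i → A i l * B l j = 0 := fun l hl => by
    rcases lt_or_gt_of_ne hl with h | h
    · rw [hB l j (h.trans_le hij), mul_zero]
    · rw [hA i l h, zero_mul]
  rw [Matrix.mul_apply, Finset.sum_eq_single i (fun l _ hl => h l hl) (by simp)]
  split_ifs with e
  · rw [e]
  · rw [hB i j (lt_of_le_of_ne hij e), mul_zero]

end Triangular

/-! ### Ordered products -/

section OrderedProducts

variable {R : Type*} [Ring R] {n : ℕ}

theorem ascProd_zero (f : Fin n → R) (h : 0 < n) : ascProd f ⟨0, h⟩ = 1 := by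
  simp [ascProd]

theorem descProd_zero (f : Fin n → R) (h : 0 < n) : descProd f ⟨0, h⟩ = 1 := by
  simp [descProd]

theorem ascProd_succ (f : Fin n → R) (i : ℕ) (h : i + 1 < n) :
    ascProd f ⟨i + 1, h⟩ = ascProd f ⟨i, by omega⟩ * f ⟨i, by omega⟩ := by
  simp only [ascProd]
  rw [List.ofFn_succ', List.concat_eq_append, List.prod_append, List.prod_singleton]
  rfl

theorem descProd_succ (f : Fin n → R) (i : ℕ) (h : i + 1 < n) :
    descProd f ⟨i + 1, h⟩ = f ⟨i, by omega⟩ * descProd f ⟨i, by omega⟩ := by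
  simp only [descProd]
  rw [List.ofFn_succ', List.concat_eq_append, List.reverse_append, List.prod_append,
    List.reverse_singleton, List.prod_singleton]
  rfl

/-- The product telescopes from the middle outwards. The last index never enters, so `u_n^{(1)}
u_n^{(2)}` may fail to be invertible. -/
theorem descProd_mul_ascProd (f g : Fin n → R)
    (hfg : ∀ k : Fin n, k.val + 1 < n → g k * f k = 1) (i : Fin n) :
    descProd g i * ascProd f i = 1 := by
  obtain ⟨i, hi⟩ := i
  induction i with
  | zero => rw [ascProd_zero, descProd_zero, one_mul]
  | succ i ih =>
    rw [ascProd_succ, descProd_succ, mul_assoc, ← mul_assoc (descProd g _), ih, one_mul, hfg _ hi]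

/-- Shifting the parentheses in `w_j (H_{j-1} w_{j-1}) ⋯ (H_1 w_1)` when `w_1 = 1`. -/
theorem mul_descProd_mul (H : Fin n → R) (w : Fin (n + 1) → R) (hw : w 0 = 1) (j : Fin n) :
    w j.castSucc * descProd (fun k => H k * w k.castSucc) j =
      descProd (fun k => w k.succ * H k) j := by
  obtain ⟨j, hj⟩ := j
  induction j with
  | zero => rw [descProd_zero, descProd_zero, mul_one]; exact hw
  | succ j ih => rw [descProd_succ, descProd_succ, ← ih, mul_assoc, mul_assoc]; rfl

end OrderedProducts

/-! ### Quasi-determinants along trailing minors -/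

section TrailingMinors

variable {R : Type*} [Ring R] {n : ℕ}

theorem lt_tailIdx (k : Fin n) (a : Fin (n - (k.val + 1))) : k < tailIdx k a := by
  rw [Fin.lt_def]
  simp only [tailIdx]
  omega

theorem exists_tailIdx_eq {k j : Fin n} (h : k < j) : ∃ a, tailIdx k a = j := by
  rw [Fin.lt_def] at h
  refine ⟨⟨j.val - (k.val + 1), by omega⟩, ?_⟩
  ext
  simp only [tailIdx]
  omega

/-- The inverse of the trailing submatrix `J^{k+1, …, n}_{k+1, …, n}`. -/
noncomputable def tailInv (J : Matrix (Fin n) (Fin n) R) (k : Fin n) :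
    Matrix (Fin (n - (k.val + 1))) (Fin (n - (k.val + 1))) R :=
  Ring.inverse (J.submatrix (tailIdx k) (tailIdx k))

theorem submatrix_consTail_succAbove {S : Type*} {n : ℕ} (J : Matrix (Fin n) (Fin n) S)
    (k i j : Fin n) :
    (J.submatrix (consTail i k) (consTail j k)).submatrix (Fin.succAbove 0) (Fin.succAbove 0) =
      J.submatrix (tailIdx k) (tailIdx k) := by
  ext a b
  simp [consTail]

/-- The deleted block does not depend on `i` and `j`, so row `i` and column `j` enter linearly
around the fixed matrix `tailInv J k`. -/
theorem minorQD_eq (J : Matrix (Fin n) (Fin n) R) (k i j : Fin n) :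
    minorQD J k i j =
      J i j - ∑ a, ∑ b, J i (tailIdx k a) * tailInv J k a b * J (tailIdx k b) j := by
  rw [minorQD, quasiDet, submatrix_consTail_succAbove, tailInv]
  simp [consTail]

theorem colQD_eq (X J : Matrix (Fin n) (Fin n) R) (i j : Fin n) :
    colQD X J i j =
      X i j - ∑ a, ∑ b, J i (tailIdx i a) * tailInv J i a b * X (tailIdx i b) j := by
  rw [colQD, quasiDet, tailInv]
  rfl

theorem rowQD_eq (Y J : Matrix (Fin n) (Fin n) R) (j i : Fin n) :
    rowQD Y J j i =
      Y j i - ∑ a, ∑ b, Y j (tailIdx i a) * tailInv J i a b * J (tailIdx i b) i := by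
  rw [rowQD, quasiDet, tailInv]
  rfl

theorem colQD_self (J : Matrix (Fin n) (Fin n) R) (k j : Fin n) :
    colQD J J k j = minorQD J k k j := by
  rw [colQD_eq, minorQD_eq]

theorem rowQD_self (J : Matrix (Fin n) (Fin n) R) (i k : Fin n) :
    rowQD J J i k = minorQD J k i k := by
  rw [rowQD_eq, minorQD_eq]

/-! ### Elimination matrices and the triangular factorization of `J`. -/

/-- The unitriangular matrix that eliminates the entries of `J` above the diagonal. -/
noncomputable def upperElim (J : Matrix (Fin n) (Fin n) R) : Matrix (Fin n) (Fin n) R :=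
  Matrix.of fun k l => (1 : Matrix (Fin n) (Fin n) R) k l -
    ∑ a, ∑ b, J k (tailIdx k a) * tailInv J k a b *
      (1 : Matrix (Fin n) (Fin n) R) (tailIdx k b) l

/-- The unitriangular matrix that eliminates the entries of `J` below the diagonal. -/
noncomputable def lowerElim (J : Matrix (Fin n) (Fin n) R) : Matrix (Fin n) (Fin n) R :=
  Matrix.of fun l k => (1 : Matrix (Fin n) (Fin n) R) l k -
    ∑ a, ∑ b, (1 : Matrix (Fin n) (Fin n) R) l (tailIdx k a) * tailInv J k a b *
      J (tailIdx k b) k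

/-- `colQD X J k j` is a combination of the entries of column `j` of `X`, with left coefficients
depending only on `k` and `J`. These coefficients form row `k` of `upperElim J`. -/
theorem upperElim_mul (X J : Matrix (Fin n) (Fin n) R) :
    upperElim J * X = Matrix.of (colQD X J) := by
  ext k j
  rw [Matrix.mul_apply, Matrix.of_apply, colQD_eq]
  simp only [upperElim, Matrix.of_apply, sub_mul, Finset.sum_sub_distrib]
  rw [← Matrix.mul_apply, one_mul]
  congr 1
  simp only [Finset.sum_mul]
  rw [Finset.sum_comm]
  refine Finset.sum_congr rfl fun a _ => ?_
  rw [Finset.sum_comm]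
  refine Finset.sum_congr rfl fun b _ => ?_
  simp [Matrix.one_apply]

theorem mul_lowerElim (Y J : Matrix (Fin n) (Fin n) R) :
    Y * lowerElim J = Matrix.of (rowQD Y J) := by
  ext j k
  rw [Matrix.mul_apply, Matrix.of_apply, rowQD_eq]
  simp only [lowerElim, Matrix.of_apply, mul_sub, Finset.sum_sub_distrib]
  rw [← Matrix.mul_apply, mul_one]
  congr 1
  simp only [Finset.mul_sum]
  rw [Finset.sum_comm]
  refine Finset.sum_congr rfl fun a _ => ?_
  rw [Finset.sum_comm]
  refine Finset.sum_congr rfl fun b _ => ?_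
  simp [Matrix.one_apply, ← mul_assoc]

theorem upperElim_apply_of_le (J : Matrix (Fin n) (Fin n) R) {k l : Fin n} (h : l ≤ k) :
    upperElim J k l = (1 : Matrix (Fin n) (Fin n) R) k l := by
  rw [upperElim, Matrix.of_apply, sub_eq_self]
  refine Finset.sum_eq_zero fun a _ => Finset.sum_eq_zero fun b _ => ?_
  rw [Matrix.one_apply_ne (h.trans_lt (lt_tailIdx k b)).ne', mul_zero]

theorem lowerElim_apply_of_le (J : Matrix (Fin n) (Fin n) R) {k l : Fin n} (h : l ≤ k) :
    lowerElim J l k = (1 : Matrix (Fin n) (Fin n) R) l k := by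
  rw [lowerElim, Matrix.of_apply, sub_eq_self]
  refine Finset.sum_eq_zero fun a _ => Finset.sum_eq_zero fun b _ => ?_
  rw [Matrix.one_apply_ne (h.trans_lt (lt_tailIdx k a)).ne, zero_mul, zero_mul]

theorem isUnit_upperElim (J : Matrix (Fin n) (Fin n) R) : IsUnit (upperElim J) :=
  isUnit_of_unitriangular (fun i => i.val) _ fun _ _ h => upperElim_apply_of_le J h

theorem isUnit_lowerElim (J : Matrix (Fin n) (Fin n) R) : IsUnit (lowerElim J) :=
  isUnit_of_unitriangular (fun i => n - i.val) _ fun i j h =>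
    lowerElim_apply_of_le J (by rw [Fin.le_def]; omega)

theorem upperElim_apply_of_lt (J : Matrix (Fin n) (Fin n) R) (i j : Fin n) (h : j < i) :
    upperElim J i j = 0 := by
  rw [upperElim_apply_of_le J h.le, Matrix.one_apply_ne h.ne']

theorem lowerElim_apply_of_lt (J : Matrix (Fin n) (Fin n) R) (i j : Fin n) (h : i < j) :
    lowerElim J i j = 0 := by
  rw [lowerElim_apply_of_le J h.le, Matrix.one_apply_ne h.ne]

theorem upperElim_apply_self (J : Matrix (Fin n) (Fin n) R) (i : Fin n) : upperElim J i i = 1 := by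
  rw [upperElim_apply_of_le J le_rfl, Matrix.one_apply_eq]

theorem lowerElim_apply_self (J : Matrix (Fin n) (Fin n) R) (i : Fin n) : lowerElim J i i = 1 := by
  rw [lowerElim_apply_of_le J le_rfl, Matrix.one_apply_eq]

/-- Column `j` of `X` vanishes below row `k`. -/
theorem colQD_of_upper {X : Matrix (Fin n) (Fin n) R} (hX : ∀ i j, j < i → X i j = 0)
    (J : Matrix (Fin n) (Fin n) R) {k j : Fin n} (h : j ≤ k) : colQD X J k j = X k j := by
  rw [← Matrix.of_apply (colQD X J), ← upperElim_mul,
    mul_apply_of_upper (upperElim_apply_of_lt J) hX h, upperElim_apply_self, one_mul]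
  split_ifs with e
  · rw [e]
  · rw [hX k j (lt_of_le_of_ne h (Ne.symm e))]

/-- Row `j` of `Y` vanishes to the right of column `k`, so only the corner entry survives. -/
theorem rowQD_of_lower {Y : Matrix (Fin n) (Fin n) R} (hY : ∀ i j, i < j → Y i j = 0)
    (J : Matrix (Fin n) (Fin n) R) {j k : Fin n} (h : j ≤ k) : rowQD Y J j k = Y j k := by
  rw [← Matrix.of_apply (rowQD Y J), ← mul_lowerElim,
    mul_apply_of_lower hY (lowerElim_apply_of_lt J) h, lowerElim_apply_self, mul_one]
  split_ifs with e
  · rw [e]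
  · rw [hY j k (lt_of_le_of_ne h e)]

/-- Column `j` already occurs among the columns `k+1, …, n`: the inverse block sends it to a
standard basis vector, and the correction term reproduces `J i j`. -/
theorem minorQD_eq_zero_right {J : Matrix (Fin n) (Fin n) R} {k : Fin n}
    (hk : IsUnit (J.submatrix (tailIdx k) (tailIdx k))) (i : Fin n) {j : Fin n} (h : k < j) :
    minorQD J k i j = 0 := by
  obtain ⟨c, rfl⟩ := exists_tailIdx_eq h
  have e : ∀ a, ∑ b, tailInv J k a b * J (tailIdx k b) (tailIdx k c) =
      (1 : Matrix _ _ R) a c := fun a => by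
    rw [← Ring.inverse_mul_cancel _ hk, Matrix.mul_apply]
    rfl
  rw [minorQD_eq]
  simp only [mul_assoc, ← Finset.mul_sum, e]
  simp [Matrix.one_apply]

theorem minorQD_eq_zero_left {J : Matrix (Fin n) (Fin n) R} {k : Fin n}
    (hk : IsUnit (J.submatrix (tailIdx k) (tailIdx k))) {i : Fin n} (j : Fin n) (h : k < i) :
    minorQD J k i j = 0 := by
  obtain ⟨c, rfl⟩ := exists_tailIdx_eq h
  have e : ∀ b, ∑ a, J (tailIdx k c) (tailIdx k a) * tailInv J k a b =
      (1 : Matrix _ _ R) c b := fun b => by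
    rw [← Ring.mul_inverse_cancel _ hk, Matrix.mul_apply]
    rfl
  rw [minorQD_eq, Finset.sum_comm]
  simp only [← Finset.sum_mul, e]
  simp [Matrix.one_apply]

/-- The triangular factorization of a matrix with invertible trailing submatrices. -/
theorem upperElim_mul_mul_lowerElim {J : Matrix (Fin n) (Fin n) R}
    (hJ : ∀ k, IsUnit (J.submatrix (tailIdx k) (tailIdx k))) :
    upperElim J * J * lowerElim J = Matrix.diagonal fun k => minorQD J k k k := by
  have hB : ∀ i j, i < j → (upperElim J * J) i j = 0 := fun i j h => by
    rw [upperElim_mul, Matrix.of_apply, colQD_self, minorQD_eq_zero_right (hJ i) i h]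
  have hA : ∀ i j, j < i → (J * lowerElim J) i j = 0 := fun i j h => by
    rw [mul_lowerElim, Matrix.of_apply, rowQD_self, minorQD_eq_zero_left (hJ j) j h]
  ext i j
  -- Bracketed as `(V J) W` the product is lower times lower triangular, as `V (J W)` upper times
  -- upper. Each bracketing settles one side of the diagonal.
  rcases le_or_gt i j with h | h
  · rw [mul_apply_of_lower hB (lowerElim_apply_of_lt J) h, lowerElim_apply_self, upperElim_mul,
      Matrix.of_apply, colQD_self, mul_one, Matrix.diagonal_apply]
  · rw [mul_assoc, mul_apply_of_upper (upperElim_apply_of_lt J) hA h.le, if_neg h.ne',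
      Matrix.diagonal_apply_ne _ h.ne']

end TrailingMinors

/-! ### Quasi-Plücker coordinates of the block matrix -/

section Coordinates

variable {R : Type*} [Ring R] {n : ℕ}

theorem quasiDet_lowerRows_inl (Lp1 Lm1 Lp2 Lm2 : Matrix (Fin n) (Fin n) R) (k j : Fin n) :
    quasiDet ((lowerRows (blockM Lp1 Lm1 Lp2 Lm2) k).submatrix id
      (Fin.cons (Sum.inl j) (fun l => Sum.inr (tailIdx k l)) :
        Fin (n - (k.val + 1) + 1) → Fin n ⊕ Fin n)) 0 0 =
      colQD (Lp1 * Lp2) (Lm1 * Lp2) k j := by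
  rw [colQD]
  congr 1
  ext a b
  cases b using Fin.cases <;> simp [lowerRows, blockM]

theorem lowerRows_submatrix_inr (Lp1 Lm1 Lp2 Lm2 : Matrix (Fin n) (Fin n) R) (k j : Fin n) :
    (lowerRows (blockM Lp1 Lm1 Lp2 Lm2) k).submatrix id
      (Fin.cons (Sum.inr j) (fun l => Sum.inr (tailIdx k l)) :
        Fin (n - (k.val + 1) + 1) → Fin n ⊕ Fin n) =
      (Lm1 * Lp2).submatrix (consTail k k) (consTail j k) := by
  ext a b
  cases b using Fin.cases <;> simp [lowerRows, blockM, consTail]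

theorem quasiDet_rightCols_inl (Lp1 Lm1 Lp2 Lm2 : Matrix (Fin n) (Fin n) R) (k j : Fin n) :
    quasiDet ((rightCols (blockM Lp1 Lm1 Lp2 Lm2) k).submatrix
      (Fin.cons (Sum.inl j) (fun l => Sum.inr (tailIdx k l)) :
        Fin (n - (k.val + 1) + 1) → Fin n ⊕ Fin n) id) 0 0 =
      rowQD (Lm1 * Lm2) (Lm1 * Lp2) j k := by
  rw [rowQD]
  congr 1
  ext a b
  cases a using Fin.cases <;> simp [rightCols, blockM]

theorem quasiDet_rightCols_inr (Lp1 Lm1 Lp2 Lm2 : Matrix (Fin n) (Fin n) R) (k i : Fin n) :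
    quasiDet ((rightCols (blockM Lp1 Lm1 Lp2 Lm2) k).submatrix
      (Fin.cons (Sum.inr i) (fun l => Sum.inr (tailIdx k l)) :
        Fin (n - (k.val + 1) + 1) → Fin n ⊕ Fin n) id) 0 0 =
      minorQD (Lm1 * Lp2) k i k := by
  rw [minorQD]
  congr 1
  ext a b
  cases a using Fin.cases <;> simp [rightCols, blockM, consTail]

/-- Row `0` of `lowerRows` is row `k` of the unbarred block, so the quasi-determinant to be inverted
is `H_k`. -/
theorem leftQPAdmissible_lowerRows (Lp1 Lm1 Lp2 Lm2 : Matrix (Fin n) (Fin n) R) (k : Fin n)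
    (hk : QuasiDetDefined ((Lm1 * Lp2).submatrix (consTail k k) (consTail k k)) 0 0)
    (hH : IsUnit (minorQD (Lm1 * Lp2) k k k)) :
    LeftQPAdmissible (lowerRows (blockM Lp1 Lm1 Lp2 Lm2) k) (fun l => Sum.inr (tailIdx k l))
      (Sum.inr k) 0 := by
  rw [LeftQPAdmissible, lowerRows_submatrix_inr]
  exact ⟨hk, hH⟩

/-- In column `0` the deleted block is again the trailing block of `J`. The corner is now a barred
row, so the denominator comes from `Lm1 * Lm2` instead of `J`. -/
theorem rightQPAdmissible_rightCols (Lp1 Lm1 Lp2 Lm2 : Matrix (Fin n) (Fin n) R) (k : Fin n)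
    (hk : IsUnit ((Lm1 * Lp2).submatrix (tailIdx k) (tailIdx k)))
    (hw : IsUnit (rowQD (Lm1 * Lm2) (Lm1 * Lp2) k k)) :
    RightQPAdmissible (rightCols (blockM Lp1 Lm1 Lp2 Lm2) k) (fun l => Sum.inr (tailIdx k l))
      (Sum.inl k) 0 := by
  rw [RightQPAdmissible, quasiDet_rightCols_inl, QuasiDetDefined]
  refine ⟨?_, hw⟩
  convert hk using 1
  ext a b
  simp [rightCols, blockM, consTail]

theorem leftCoord_inl (Lp1 Lm1 Lp2 Lm2 : Matrix (Fin n) (Fin n) R) (k j : Fin n)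
    (h : LeftQPAdmissible (lowerRows (blockM Lp1 Lm1 Lp2 Lm2) k)
      (fun l => Sum.inr (tailIdx k l)) (Sum.inr k) 0) :
    leftCoord (blockM Lp1 Lm1 Lp2 Lm2) k (Sum.inl j) =
      Ring.inverse (minorQD (Lm1 * Lp2) k k k) * colQD (Lp1 * Lp2) (Lm1 * Lp2) k j := by
  rw [leftCoord, leftQP_eq _ _ _ _ 0 h, leftQPAt, quasiDet_lowerRows_inl,
    lowerRows_submatrix_inr, minorQD]

theorem leftCoord_inr (Lp1 Lm1 Lp2 Lm2 : Matrix (Fin n) (Fin n) R) (k j : Fin n)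
    (h : LeftQPAdmissible (lowerRows (blockM Lp1 Lm1 Lp2 Lm2) k)
      (fun l => Sum.inr (tailIdx k l)) (Sum.inr k) 0) :
    leftCoord (blockM Lp1 Lm1 Lp2 Lm2) k (Sum.inr j) =
      Ring.inverse (minorQD (Lm1 * Lp2) k k k) * minorQD (Lm1 * Lp2) k k j := by
  rw [leftCoord, leftQP_eq _ _ _ _ 0 h, leftQPAt, lowerRows_submatrix_inr,
    lowerRows_submatrix_inr, minorQD, minorQD]

theorem rightCoord_inl (Lp1 Lm1 Lp2 Lm2 : Matrix (Fin n) (Fin n) R) (k j : Fin n)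
    (h : RightQPAdmissible (rightCols (blockM Lp1 Lm1 Lp2 Lm2) k)
      (fun l => Sum.inr (tailIdx k l)) (Sum.inl k) 0) :
    rightCoord (blockM Lp1 Lm1 Lp2 Lm2) k (Sum.inl j) =
      rowQD (Lm1 * Lm2) (Lm1 * Lp2) j k *
        Ring.inverse (rowQD (Lm1 * Lm2) (Lm1 * Lp2) k k) := by
  rw [rightCoord, rightQP_eq _ _ _ _ 0 h, rightQPAt, quasiDet_rightCols_inl,
    quasiDet_rightCols_inl]

theorem rightCoord_inr (Lp1 Lm1 Lp2 Lm2 : Matrix (Fin n) (Fin n) R) (k i : Fin n)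
    (h : RightQPAdmissible (rightCols (blockM Lp1 Lm1 Lp2 Lm2) k)
      (fun l => Sum.inr (tailIdx k l)) (Sum.inl k) 0) :
    rightCoord (blockM Lp1 Lm1 Lp2 Lm2) k (Sum.inr i) =
      minorQD (Lm1 * Lp2) k i k * Ring.inverse (rowQD (Lm1 * Lm2) (Lm1 * Lp2) k k) := by
  rw [rightCoord, rightQP_eq _ _ _ _ 0 h, rightQPAt, quasiDet_rightCols_inl,
    quasiDet_rightCols_inr]

end Coordinates

/-! ### The map in terms of quasi-determinants -/

section QuasiDetMap

variable {R : Type*} [Ring R] {n : ℕ}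

theorem IsLPair.mul_upper_apply {Lp1 Lm1 Lp2 Lm2 : Matrix (Fin n) (Fin n) R}
    {u1 u2 : Fin (n + 1) → R} (h1 : IsLPair Lp1 Lm1 u1) (h2 : IsLPair Lp2 Lm2 u2) {i j : Fin n}
    (h : j ≤ i) : (Lp1 * Lp2) i j = if i = j then u1 i.succ * u2 i.succ else 0 := by
  rw [mul_apply_of_upper h1.upper h2.upper h, h1.diag_upper, h2.diag_upper]

theorem IsLPair.mul_lower_apply {Lp1 Lm1 Lp2 Lm2 : Matrix (Fin n) (Fin n) R}
    {u1 u2 : Fin (n + 1) → R} (h1 : IsLPair Lp1 Lm1 u1) (h2 : IsLPair Lp2 Lm2 u2) {i j : Fin n}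
    (h : i ≤ j) : (Lm1 * Lm2) i j = if i = j then u1 i.castSucc * u2 i.castSucc else 0 := by
  rw [mul_apply_of_lower h1.lower h2.lower h, h1.diag_lower, h2.diag_lower]

theorem IsLPair.colQD_apply {Lp1 Lm1 Lp2 Lm2 : Matrix (Fin n) (Fin n) R}
    {u1 u2 : Fin (n + 1) → R} (h1 : IsLPair Lp1 Lm1 u1) (h2 : IsLPair Lp2 Lm2 u2)
    (J : Matrix (Fin n) (Fin n) R) {i j : Fin n} (h : j ≤ i) :
    colQD (Lp1 * Lp2) J i j = if i = j then u1 i.succ * u2 i.succ else 0 := by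
  rw [colQD_of_upper (fun i j hij => ?_) J h, h1.mul_upper_apply h2 h]
  rw [h1.mul_upper_apply h2 hij.le, if_neg hij.ne']

theorem IsLPair.rowQD_apply {Lp1 Lm1 Lp2 Lm2 : Matrix (Fin n) (Fin n) R}
    {u1 u2 : Fin (n + 1) → R} (h1 : IsLPair Lp1 Lm1 u1) (h2 : IsLPair Lp2 Lm2 u2)
    (J : Matrix (Fin n) (Fin n) R) {i j : Fin n} (h : i ≤ j) :
    rowQD (Lm1 * Lm2) J i j = if i = j then u1 i.castSucc * u2 i.castSucc else 0 := by
  rw [rowQD_of_lower (fun i j hij => ?_) J h, h1.mul_lower_apply h2 h]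
  rw [h1.mul_lower_apply h2 hij.le, if_neg hij.ne]

/-- The cut-off `i ≤ j` in the definition loses nothing: below the diagonal `colQD` reduces to an
entry of an upper triangular matrix. In `qdMinus1_eq` and `qdPlus2_eq` the discarded entries vanish
because of a repeated column or row. -/
theorem qdPlus1_eq {Lp1 Lm1 Lp2 Lm2 : Matrix (Fin n) (Fin n) R}
    {u1 u2 : Fin (n + 1) → R} (h1 : IsLPair Lp1 Lm1 u1) (h2 : IsLPair Lp2 Lm2 u2) :
    qdPlus1 Lp1 Lm1 Lp2 u1 u2 =
      Matrix.diagonal (ascProd (qdFactorAsc (Lm1 * Lp2) u1 u2)) *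
        (Matrix.diagonal (fun k => Ring.inverse (minorQD (Lm1 * Lp2) k k k)) *
          (upperElim (Lm1 * Lp2) * (Lp1 * Lp2))) := by
  ext i j
  rw [Matrix.diagonal_mul, Matrix.diagonal_mul, upperElim_mul, qdPlus1, Matrix.of_apply,
    Matrix.of_apply, ← mul_assoc]
  split_ifs with h
  · rfl
  · rw [h1.colQD_apply h2 _ (not_le.1 h).le, if_neg (not_le.1 h).ne', mul_zero]

theorem qdMinus1_eq {Lm1 Lp2 : Matrix (Fin n) (Fin n) R} (u1 u2 : Fin (n + 1) → R)
    (hJ : ∀ k, IsUnit ((Lm1 * Lp2).submatrix (tailIdx k) (tailIdx k))) :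
    qdMinus1 Lm1 Lp2 u1 u2 =
      Matrix.diagonal (ascProd (qdFactorAsc (Lm1 * Lp2) u1 u2)) *
        (Matrix.diagonal (fun k => Ring.inverse (minorQD (Lm1 * Lp2) k k k)) *
          (upperElim (Lm1 * Lp2) * (Lm1 * Lp2))) := by
  ext j i
  rw [Matrix.diagonal_mul, Matrix.diagonal_mul, upperElim_mul, qdMinus1, Matrix.of_apply,
    Matrix.of_apply, ← mul_assoc, colQD_self]
  split_ifs with h
  · rfl
  · rw [minorQD_eq_zero_right (hJ j) j (not_le.1 h), mul_zero]

theorem qdPlus2_eq {Lm1 Lp2 : Matrix (Fin n) (Fin n) R} (u1 u2 : Fin (n + 1) → R)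
    (hJ : ∀ k, IsUnit ((Lm1 * Lp2).submatrix (tailIdx k) (tailIdx k))) :
    qdPlus2 Lm1 Lp2 u1 u2 =
      (Lm1 * Lp2) * lowerElim (Lm1 * Lp2) *
        Matrix.diagonal (descProd (qdFactorDesc (Lm1 * Lp2) u1 u2)) := by
  ext i j
  rw [Matrix.mul_diagonal, mul_lowerElim, qdPlus2, Matrix.of_apply, Matrix.of_apply, rowQD_self]
  split_ifs with h
  · rfl
  · rw [minorQD_eq_zero_left (hJ j) j (not_le.1 h), zero_mul]

theorem qdMinus2_eq {Lp1 Lm1 Lp2 Lm2 : Matrix (Fin n) (Fin n) R}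
    {u1 u2 : Fin (n + 1) → R} (h1 : IsLPair Lp1 Lm1 u1) (h2 : IsLPair Lp2 Lm2 u2) :
    qdMinus2 Lm1 Lp2 Lm2 u1 u2 =
      (Lm1 * Lm2) * lowerElim (Lm1 * Lp2) *
        Matrix.diagonal (descProd (qdFactorDesc (Lm1 * Lp2) u1 u2)) := by
  ext j i
  rw [Matrix.mul_diagonal, mul_lowerElim, qdMinus2, Matrix.of_apply, Matrix.of_apply]
  split_ifs with h
  · rfl
  · rw [h1.rowQD_apply h2 _ (not_le.1 h).le, if_neg (not_le.1 h).ne, zero_mul]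

theorem qdFactorDesc_mul_qdFactorAsc {J : Matrix (Fin n) (Fin n) R} {u1 u2 : Fin (n + 1) → R}
    {k : Fin n} (hu : IsUnit (u1 k.succ * u2 k.succ)) (hH : IsUnit (minorQD J k k k)) :
    qdFactorDesc J u1 u2 k * qdFactorAsc J u1 u2 k = 1 := by
  rw [qdFactorAsc, qdFactorDesc, mul_assoc, ← mul_assoc (minorQD J k k k),
    Ring.mul_inverse_cancel _ hH, one_mul, Ring.inverse_mul_cancel _ hu]

/-- Index shift from the hypothesis at `0, …, n-1` to the factors at `1, …, n-1`. -/
theorem isUnit_succ_of_castSucc {w : Fin (n + 1) → R} (hw : ∀ k : Fin n, IsUnit (w k.castSucc))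
    (k : Fin n) (hk : k.val + 1 < n) : IsUnit (w k.succ) :=
  hw ⟨k.val + 1, hk⟩

theorem zeroCurvature_qd {Lp1 Lm1 Lp2 Lm2 : Matrix (Fin n) (Fin n) R}
    {u1 u2 : Fin (n + 1) → R} (h1 : IsLPair Lp1 Lm1 u1) (h2 : IsLPair Lp2 Lm2 u2)
    (hu : ∀ k : Fin n, IsUnit (u1 k.castSucc * u2 k.castSucc))
    (hJ : ∀ k, IsUnit ((Lm1 * Lp2).submatrix (tailIdx k) (tailIdx k)))
    (hH : ∀ k, IsUnit (minorQD (Lm1 * Lp2) k k k)) :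
    ZeroCurvature Lp1 Lm1 Lp2 Lm2 (qdPlus1 Lp1 Lm1 Lp2 u1 u2) (qdMinus1 Lm1 Lp2 u1 u2)
      (qdPlus2 Lm1 Lp2 u1 u2) (qdMinus2 Lm1 Lp2 Lm2 u1 u2) := by
  rw [qdPlus1_eq h1 h2, qdMinus1_eq u1 u2 hJ, qdPlus2_eq u1 u2 hJ, qdMinus2_eq h1 h2]
  have hfac := upperElim_mul_mul_lowerElim hJ
  have hV := isUnit_upperElim (Lm1 * Lp2)
  have hW := isUnit_lowerElim (Lm1 * Lp2)
  have hP : Matrix.diagonal (descProd (qdFactorDesc (Lm1 * Lp2) u1 u2)) *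
      Matrix.diagonal (ascProd (qdFactorAsc (Lm1 * Lp2) u1 u2)) = 1 := by
    rw [Matrix.diagonal_mul_diagonal, ← Matrix.diagonal_one]
    congr 1
    funext i
    exact descProd_mul_ascProd _ _ (fun k hk => qdFactorDesc_mul_qdFactorAsc
      (isUnit_succ_of_castSucc (w := fun k => u1 k * u2 k) hu k hk) (hH k)) i
  have hDD : Matrix.diagonal (fun k => minorQD (Lm1 * Lp2) k k k) *
      Matrix.diagonal (fun k => Ring.inverse (minorQD (Lm1 * Lp2) k k k)) = 1 := by
    rw [Matrix.diagonal_mul_diagonal, ← Matrix.diagonal_one]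
    congr 1
    funext i
    exact Ring.mul_inverse_cancel _ (hH i)
  have hDD' : Matrix.diagonal (fun k => Ring.inverse (minorQD (Lm1 * Lp2) k k k)) *
      Matrix.diagonal (fun k => minorQD (Lm1 * Lp2) k k k) = 1 := by
    rw [Matrix.diagonal_mul_diagonal, ← Matrix.diagonal_one]
    congr 1
    funext i
    exact Ring.inverse_mul_cancel _ (hH i)
  generalize Matrix.diagonal (descProd (qdFactorDesc (Lm1 * Lp2) u1 u2)) = P' at hP ⊢
  generalize Matrix.diagonal (ascProd (qdFactorAsc (Lm1 * Lp2) u1 u2)) = P at hP ⊢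
  generalize Matrix.diagonal (fun k => Ring.inverse (minorQD (Lm1 * Lp2) k k k)) = D' at hDD hDD' ⊢
  generalize Matrix.diagonal (fun k => minorQD (Lm1 * Lp2) k k k) = D at hfac hDD hDD'
  -- All three right-hand sides have `P'` directly before `P`, so the ordered products disappear.
  have cancel : ∀ S T : Matrix (Fin n) (Fin n) R, S * P' * (P * T) = S * T := fun S T => by
    rw [mul_assoc, ← mul_assoc P', hP, one_mul]
  rw [ZeroCurvature, cancel, cancel, cancel]
  generalize hJ' : Lm1 * Lp2 = J at *
  generalize upperElim J = V at *
  generalize lowerElim J = W at *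
  -- The factorization gives `V (J W D⁻¹) = 1` and `(D⁻¹ V J) W = 1`; the unit `V`, respectively
  -- `W`, moves to the other side.
  have e1 : J * W * D' * V = 1 := by
    have : V * (J * W * D') = 1 := by rw [← mul_assoc, ← mul_assoc, hfac, hDD]
    exact mul_comm_eq_one_of_isUnit_left hV this
  have e2 : W * (D' * (V * J)) = 1 := by
    have : D' * (V * J) * W = 1 := by rw [mul_assoc, hfac, hDD']
    exact mul_comm_eq_one_of_isUnit_right hW this
  refine ⟨?_, ?_, ?_⟩
  · rw [← mul_assoc, ← mul_assoc, e1, one_mul]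
  · rw [← mul_assoc, ← mul_assoc, e1, one_mul]
  · rw [mul_assoc, e2, mul_one]

/-- The `i`-th diagonal entry of the lower matrix is the product of the first `i-1` factors, that of
the upper matrix the product of the first `i`, whence the shift by one. -/
theorem isLPair_qd1 {Lp1 Lm1 Lp2 Lm2 : Matrix (Fin n) (Fin n) R}
    {u1 u2 : Fin (n + 1) → R} (h1 : IsLPair Lp1 Lm1 u1) (h2 : IsLPair Lp2 Lm2 u2)
    (hH : ∀ k, IsUnit (minorQD (Lm1 * Lp2) k k k)) :
    ∃ v, IsLPair (qdPlus1 Lp1 Lm1 Lp2 u1 u2) (qdMinus1 Lm1 Lp2 u1 u2) v := by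
  have hm : ∀ i, qdMinus1 Lm1 Lp2 u1 u2 i i = ascProd (qdFactorAsc (Lm1 * Lp2) u1 u2) i := by
    intro i
    rw [qdMinus1, Matrix.of_apply, if_pos le_rfl, mul_assoc, Ring.inverse_mul_cancel _ (hH i),
      mul_one]
  have hp : ∀ i, qdPlus1 Lp1 Lm1 Lp2 u1 u2 i i =
      ascProd (qdFactorAsc (Lm1 * Lp2) u1 u2) i * qdFactorAsc (Lm1 * Lp2) u1 u2 i := by
    intro i
    rw [qdPlus1, Matrix.of_apply, if_pos le_rfl, h1.colQD_apply h2 _ le_rfl, if_pos rfl,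
      mul_assoc]
    rfl
  refine ⟨Fin.cons 1 fun i => qdPlus1 Lp1 Lm1 Lp2 u1 u2 i i, ?_, ?_, ?_, ?_, ?_⟩
  · intro i j h
    rw [qdPlus1, Matrix.of_apply, if_neg h.not_ge]
  · intro i j h
    rw [qdMinus1, Matrix.of_apply, if_neg h.not_ge]
  · intro i
    rw [Fin.cons_succ]
  · rintro ⟨i, hi⟩
    rw [hm]
    cases i with
    | zero => rw [ascProd_zero]; rfl
    | succ i => rw [ascProd_succ, ← hp]; rfl
  · rfl

theorem isLPair_qd2 {Lp1 Lm1 Lp2 Lm2 : Matrix (Fin n) (Fin n) R}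
    {u1 u2 : Fin (n + 1) → R} (h1 : IsLPair Lp1 Lm1 u1) (h2 : IsLPair Lp2 Lm2 u2)
    (hu : ∀ k : Fin n, IsUnit (u1 k.castSucc * u2 k.castSucc)) :
    ∃ v, IsLPair (qdPlus2 Lm1 Lp2 u1 u2) (qdMinus2 Lm1 Lp2 Lm2 u1 u2) v := by
  have hp : ∀ i, qdPlus2 Lm1 Lp2 u1 u2 i i =
      minorQD (Lm1 * Lp2) i i i * descProd (qdFactorDesc (Lm1 * Lp2) u1 u2) i := by
    intro i
    rw [qdPlus2, Matrix.of_apply, if_pos le_rfl]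
  have hm : ∀ i, qdMinus2 Lm1 Lp2 Lm2 u1 u2 i i =
      u1 i.castSucc * u2 i.castSucc * descProd (qdFactorDesc (Lm1 * Lp2) u1 u2) i := by
    intro i
    rw [qdMinus2, Matrix.of_apply, if_pos le_rfl, h1.rowQD_apply h2 _ le_rfl, if_pos rfl]
  refine ⟨Fin.cons 1 fun i => qdPlus2 Lm1 Lp2 u1 u2 i i, ?_, ?_, ?_, ?_, ?_⟩
  · intro i j h
    rw [qdPlus2, Matrix.of_apply, if_neg h.not_ge]
  · intro i j h
    rw [qdMinus2, Matrix.of_apply, if_neg h.not_ge]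
  · intro i
    rw [Fin.cons_succ]
  · rintro ⟨i, hi⟩
    rw [hm]
    cases i with
    | zero =>
      have e1 : u1 (Fin.castSucc ⟨0, hi⟩) = 1 := h1.u_zero
      have e2 : u2 (Fin.castSucc ⟨0, hi⟩) = 1 := h2.u_zero
      rw [descProd_zero, e1, e2, one_mul, one_mul]
      rfl
    | succ i =>
      have hw := hu ⟨i + 1, hi⟩
      -- The successor of `i` and the cast of `i + 1` are the same index, so the leading factor of
      -- the descending product inverts exactly the `u`-product in front of it.
      have e : qdFactorDesc (Lm1 * Lp2) u1 u2 ⟨i, by omega⟩ =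
          Ring.inverse (u1 (Fin.castSucc ⟨i + 1, hi⟩) * u2 (Fin.castSucc ⟨i + 1, hi⟩)) *
            minorQD (Lm1 * Lp2) ⟨i, by omega⟩ ⟨i, by omega⟩ ⟨i, by omega⟩ := rfl
      rw [descProd_succ, e, mul_assoc (Ring.inverse _), ← mul_assoc _ (Ring.inverse _),
        Ring.mul_inverse_cancel _ hw, one_mul, ← hp]
      rfl
  · rfl

end QuasiDetMap

/-! ### Comparison of coordinates with quasi-determinants, and conclusion. -/

theorem theorem2p5 {R : Type*} [Ring R] {n : ℕ}
    (Lp1 Lm1 Lp2 Lm2 : Matrix (Fin n) (Fin n) R) (u1 u2 : Fin (n + 1) → R)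
    (h1 : IsLPair Lp1 Lm1 u1) (h2 : IsLPair Lp2 Lm2 u2)
    -- `u_k^{(1)} u_k^{(2)}` is invertible for `0 ≤ k ≤ n - 1`
    (hu : ∀ k : Fin n, IsUnit (u1 k.castSucc * u2 k.castSucc))
    -- `|J^{k, …, n}_{k, …, n}|_{kk}` is well defined and invertible for `1 ≤ k ≤ n`
    (hJ : ∀ k : Fin n,
      QuasiDetDefined ((Lm1 * Lp2).submatrix (consTail k k) (consTail k k)) 0 0 ∧
        IsUnit (minorQD (Lm1 * Lp2) k k k)) :
    let M := blockM Lp1 Lm1 Lp2 Lm2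
    -- all quasi-Plücker coordinates that occur are well defined
    (∀ k : Fin n,
      LeftQPDefined (lowerRows M k) (fun l => Sum.inr (tailIdx k l)) (Sum.inr k) ∧
        RightQPDefined (rightCols M k) (fun l => Sum.inr (tailIdx k l)) (Sum.inl k)) ∧
    -- the expressions in quasi-Plücker coordinates agree with those in quasi-determinants
    (qpPlus1 M = qdPlus1 Lp1 Lm1 Lp2 u1 u2 ∧ qpMinus1 M = qdMinus1 Lm1 Lp2 u1 u2 ∧
      qpPlus2 M = qdPlus2 Lm1 Lp2 u1 u2 ∧ qpMinus2 M = qdMinus2 Lm1 Lp2 Lm2 u1 u2) ∧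
    -- they satisfy the conditions on the matrix entries and solve the zero-curvature relation
    (∃ v1 v2 : Fin (n + 1) → R,
      IsLPair (qpPlus1 M) (qpMinus1 M) v1 ∧ IsLPair (qpPlus2 M) (qpMinus2 M) v2) ∧
    ZeroCurvature Lp1 Lm1 Lp2 Lm2 (qpPlus1 M) (qpMinus1 M) (qpPlus2 M) (qpMinus2 M) := by
  have hJ' : ∀ k, IsUnit ((Lm1 * Lp2).submatrix (tailIdx k) (tailIdx k)) := fun k => by
    rw [← submatrix_consTail_succAbove (Lm1 * Lp2) k k k]
    exact (hJ k).1
  have hH := fun k => (hJ k).2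
  have hcol : ∀ k, colQD (Lp1 * Lp2) (Lm1 * Lp2) k k = u1 k.succ * u2 k.succ := fun k => by
    rw [h1.colQD_apply h2 _ le_rfl, if_pos rfl]
  have hrow : ∀ k, rowQD (Lm1 * Lm2) (Lm1 * Lp2) k k = u1 k.castSucc * u2 k.castSucc :=
    fun k => by rw [h1.rowQD_apply h2 _ le_rfl, if_pos rfl]
  have hl := fun k => leftQPAdmissible_lowerRows Lp1 Lm1 Lp2 Lm2 k (hJ k).1 (hH k)
  have hr := fun k => rightQPAdmissible_rightCols Lp1 Lm1 Lp2 Lm2 k (hJ' k) (by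
    rw [hrow]
    exact hu k)
  have hasc : (fun k => leftCoord (blockM Lp1 Lm1 Lp2 Lm2) k (Sum.inl k)) =
      qdFactorAsc (Lm1 * Lp2) u1 u2 := by
    funext k
    rw [leftCoord_inl _ _ _ _ _ _ (hl k), hcol, qdFactorAsc]
  -- Here `r_{k,k̄} = H_k (u_{k-1}^{(1)} u_{k-1}^{(2)})⁻¹`, while the target factor is `(u_k^{(1)}
  -- u_k^{(2)})⁻¹ H_k`. The inverse in front, supplied by the coordinate left of the product, shifts
  -- the bracketing; the surplus last inverse is that of `u_0^{(1)} u_0^{(2)} = 1`.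
  have hdesc : ∀ j, Ring.inverse (u1 j.castSucc * u2 j.castSucc) *
      descProd (fun k => rightCoord (blockM Lp1 Lm1 Lp2 Lm2) k (Sum.inr k)) j =
        descProd (qdFactorDesc (Lm1 * Lp2) u1 u2) j := fun j => by
    have e : (fun k => rightCoord (blockM Lp1 Lm1 Lp2 Lm2) k (Sum.inr k)) = fun k =>
        minorQD (Lm1 * Lp2) k k k * Ring.inverse (u1 k.castSucc * u2 k.castSucc) := by
      funext k
      rw [rightCoord_inr _ _ _ _ _ _ (hr k), hrow]
    rw [e]
    exact mul_descProd_mul (fun k => minorQD (Lm1 * Lp2) k k k)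
      (fun k => Ring.inverse (u1 k * u2 k)) (by simp [h1.u_zero, h2.u_zero]) j
  have hp1 : qpPlus1 (blockM Lp1 Lm1 Lp2 Lm2) = qdPlus1 Lp1 Lm1 Lp2 u1 u2 := by
    ext i j
    rw [qpPlus1, qdPlus1, Matrix.of_apply, Matrix.of_apply, hasc,
      leftCoord_inl _ _ _ _ _ _ (hl i), mul_assoc]
  have hm1 : qpMinus1 (blockM Lp1 Lm1 Lp2 Lm2) = qdMinus1 Lm1 Lp2 u1 u2 := by
    ext j i
    rw [qpMinus1, qdMinus1, Matrix.of_apply, Matrix.of_apply, hasc,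
      leftCoord_inr _ _ _ _ _ _ (hl j), mul_assoc]
  have hp2 : qpPlus2 (blockM Lp1 Lm1 Lp2 Lm2) = qdPlus2 Lm1 Lp2 u1 u2 := by
    ext i j
    rw [qpPlus2, qdPlus2, Matrix.of_apply, Matrix.of_apply, ← hdesc,
      rightCoord_inr _ _ _ _ _ _ (hr j), hrow, mul_assoc]
  have hm2 : qpMinus2 (blockM Lp1 Lm1 Lp2 Lm2) = qdMinus2 Lm1 Lp2 Lm2 u1 u2 := by
    ext j i
    rw [qpMinus2, qdMinus2, Matrix.of_apply, Matrix.of_apply, ← hdesc,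
      rightCoord_inl _ _ _ _ _ _ (hr i), hrow, mul_assoc]
  intro M
  refine ⟨fun k => ⟨⟨0, hl k⟩, ⟨0, hr k⟩⟩, ⟨hp1, hm1, hp2, hm2⟩, ?_, ?_⟩
  · obtain ⟨v1, hv1⟩ := isLPair_qd1 h1 h2 hH
    obtain ⟨v2, hv2⟩ := isLPair_qd2 h1 h2 hu
    refine ⟨v1, v2, ?_, ?_⟩
    · rw [hp1, hm1]
      exact hv1
    · rw [hp2, hm2]
      exact hv2
  · rw [hp1, hm1, hp2, hm2]
    exact zeroCurvature_qd h1 h2 hu hJ' hH
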